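/- Let $d \ge 1$ and $n = \binom{d+1}{2}$. Identify quadratic forms with real symmetric $d\times d$ matrices and write $Q[x] = x^tQx$. For a positive definite $Q$ let $\lambda_1(Q) = \min_{x \in \mathbb{Z}^d\setminus\{0\}} Q[x]$ and $\operatorname{Min} Q = \{x \in \mathbb{Z}^d : Q[x] = \lambda_1(Q)\}$; let its Voronoi domain $\mathcal{V}(Q)$ be the set of all non-negative real linear combinations of the matrices $xx^t$, $x \in \operatorname{Min} Q$. A positive definite $Q$ is called perfect if $P = Q$ is the only real symmetric $P$ with $P[x] = \lambda_1(Q)$ for all $x \in \operatorname{Min} Q$. Two forms $Q, Q'$ are arithmetically equivalent if $Q' = U^tQU$ for some $U \in \mathbb{Z}^{d\times d}$ with $|\det U| = 1$. Let $T_d$ be the set of real symmetric $d\times d$ matrices $P$ with $\operatorname{Tr}(P) \le 1$. For an ordering of the pairs $(i,j)$ with $1 \le i \le j \le d$, let $\phi$ be the isometry from the real symmetric $d\times d$ matrices (with inner product $\langle P, R\rangle = \operatorname{Tr}(P^tR)$) to $\mathbb{R}^n$ that sends $P$ to the vector with entries $P_{ii}$ and $\sqrt{2}\,P_{ij}$ $(i<j)$.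 Then for every perfect form $Q$ in $d$ variables there is a perfect form $Q'$ arithmetically equivalent to $Q$ such that, for every ordering of the pairs, $$\operatorname{vol}_n\bigl(\phi(\mathcal{V}(Q') \cap T_d)\bigr) \;\ge\; \ell_d := \frac{1}{n!}\cdot\frac{2^{(n-d)/2}}{\bigl(\tfrac18 d^3(d+7)\bigr)^n}.$$ -/

import Mathlib

open Matrix MeasureTheory

namespace PerfectForms

/-- The value `Q[x] = xᵗ Q x` of the quadratic form with matrix `Q` at an integral vector. -/
def value {d : ℕ} (Q : Matrix (Fin d) (Fin d) ℝ) (x : Fin d → ℤ) : ℝ :=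
  (fun i => (x i : ℝ)) ⬝ᵥ (Q *ᵥ fun i => (x i : ℝ))

/-- The arithmetical minimum of `Q` over nonzero integral vectors. For positive definite `Q`
and `1 ≤ d` the infimum is attained. -/
noncomputable def arithMin {d : ℕ} (Q : Matrix (Fin d) (Fin d) ℝ) : ℝ :=
  sInf {r : ℝ | ∃ x : Fin d → ℤ, x ≠ 0 ∧ r = value Q x}

/-- The set of minimal vectors of `Q`. -/
def minVectors {d : ℕ} (Q : Matrix (Fin d) (Fin d) ℝ) : Set (Fin d → ℤ) :=
  {x | value Q x = arithMin Q}

/-- The rank one form `x xᵗ` of an integral vector. -/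
def rankOne {d : ℕ} (x : Fin d → ℤ) : Matrix (Fin d) (Fin d) ℝ :=
  Matrix.of fun i j => (x i : ℝ) * (x j : ℝ)

/-- The Voronoi domain of `Q`: all non-negative linear combinations of the matrices `x xᵗ`,
where `x` runs over the minimal vectors of `Q`. -/
def voronoiDomain {d : ℕ} (Q : Matrix (Fin d) (Fin d) ℝ) : Set (Matrix (Fin d) (Fin d) ℝ) :=
  (Submodule.span NNReal (rankOne '' minVectors Q) :
    Submodule NNReal (Matrix (Fin d) (Fin d) ℝ))

/-- A perfect form: positive definite (in particular symmetric) and determined among all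
symmetric matrices by its minimum and its minimal vectors. -/
def IsPerfect {d : ℕ} (Q : Matrix (Fin d) (Fin d) ℝ) : Prop :=
  Q.PosDef ∧
    ∀ P : Matrix (Fin d) (Fin d) ℝ, P.IsSymm →
      (∀ x ∈ minVectors Q, value P x = arithMin Q) → P = Q

/-- Arithmetical equivalence: `Q' = Uᵗ Q U` for an integral matrix `U` with `|det U| = 1`. -/
def ArithEquiv {d : ℕ} (Q Q' : Matrix (Fin d) (Fin d) ℝ) : Prop :=
  ∃ U : Matrix (Fin d) (Fin d) ℤ, |U.det| = 1 ∧
    Q' = (U.map (Int.cast : ℤ → ℝ))ᵀ * Q * U.map (Int.cast : ℤ → ℝ)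

/-- The half-space of symmetric matrices of trace at most one. -/
def traceHalfSpace (d : ℕ) : Set (Matrix (Fin d) (Fin d) ℝ) :=
  {P | P.IsSymm ∧ P.trace ≤ 1}

/-- The dimension `n = d (d + 1) / 2` of the space of symmetric `d × d` matrices. -/
abbrev symDim (d : ℕ) : ℕ := (d + 1).choose 2

/-- The index pairs `(i, j)` with `i ≤ j`. -/
abbrev UpperPairs (d : ℕ) : Type := {p : Fin d × Fin d // p.1 ≤ p.2}

/-- There are `n` index pairs, so orderings `UpperPairs d ≃ Fin (symDim d)` exist. -/
theorem card_upperPairs (d : ℕ) : Fintype.card (UpperPairs d) = symDim d := by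
  have h : ∀ j : Fin d, (Finset.univ.filter fun i : Fin d => i ≤ j).card = (j : ℕ) + 1 := by
    intro j
    have : (Finset.univ.filter fun i : Fin d => i ≤ j) = Finset.Iic j := by
      ext i; simp
    rw [this, Fin.card_Iic]
  rw [Fintype.card_subtype, Finset.card_filter, Fintype.sum_prod_type_right]
  simp only [← Finset.card_filter, h]
  rw [Fin.sum_univ_eq_sum_range (fun k => k + 1) d]
  clear h
  induction d with
  | zero => rfl
  | succ m ih =>
    rw [Finset.sum_range_succ, ih, symDim, symDim, Nat.choose_succ_succ' (m + 1) 1,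
      Nat.choose_one_right, add_comm]

/-- The map `φ`, for a given ordering `e` of the index pairs `i ≤ j`: the coordinates of
`φ(P)` are `P i i` for `i = j` and `√2 * P i j` for `i < j`. On symmetric matrices it is
an isometry from the trace inner product to the standard inner product (see `inner_phi`). -/
noncomputable def phi {d : ℕ} (e : UpperPairs d ≃ Fin (symDim d))
    (P : Matrix (Fin d) (Fin d) ℝ) : EuclideanSpace ℝ (Fin (symDim d)) :=
  WithLp.toLp 2 fun k =>
    if (e.symm k).1.1 = (e.symm k).1.2 then P (e.symm k).1.1 (e.symm k).1.2
    else √2 * P (e.symm k).1.1 (e.symm k).1.2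

theorem inner_phi {d : ℕ} (e : UpperPairs d ≃ Fin (symDim d))
    (P R : Matrix (Fin d) (Fin d) ℝ) (hP : P.IsSymm) (hR : R.IsSymm) :
    inner ℝ (phi e P) (phi e R) = (Pᵀ * R).trace := by
  have hs2 : √2 * √2 = (2 : ℝ) := Real.mul_self_sqrt (by norm_num)
  have hsymP : ∀ i j, P j i = P i j := fun i j => hP.apply i j
  have hsymR : ∀ i j, R j i = R i j := fun i j => hR.apply i j
  let f : Fin d → Fin d → ℝ := fun i j => P i j * R i j
  have hf : ∀ i j, f j i = f i j := fun i j => by simp only [f, hsymP i j, hsymR i j]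
  have h1 : inner ℝ (phi e P) (phi e R) =
      ∑ p : UpperPairs d, if p.1.1 = p.1.2 then f p.1.1 p.1.2 else 2 * f p.1.1 p.1.2 := by
    rw [PiLp.inner_apply, ← e.sum_comp]
    refine Finset.sum_congr rfl fun p _ => ?_
    simp only [phi, Equiv.symm_apply_apply, f]
    split_ifs
    · simp [mul_comm]
    · simp only [RCLike.inner_apply, conj_trivial]
      linear_combination (P p.1.1 p.1.2 * R p.1.1 p.1.2) * hs2
  have h2 : ∑ p : UpperPairs d, (if p.1.1 = p.1.2 then f p.1.1 p.1.2 else 2 * f p.1.1 p.1.2) =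
      ∑ i, ∑ j, (if i ≤ j then (if i = j then f i j else 2 * f i j) else 0) := by
    rw [← Fintype.sum_prod_type' (fun i j : Fin d =>
      if i ≤ j then (if i = j then f i j else 2 * f i j) else 0), ← Finset.sum_filter]
    exact (Finset.sum_subtype (p := fun p : Fin d × Fin d => p.1 ≤ p.2) _ (by simp)
      (fun p : Fin d × Fin d => if p.1 = p.2 then f p.1 p.2 else 2 * f p.1 p.2)).symm
  have h3 : (Pᵀ * R).trace = ∑ i, ∑ j, f i j := by
    simp only [Matrix.trace, Matrix.diag, Matrix.mul_apply, Matrix.transpose_apply, f]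
    exact Finset.sum_comm
  rw [h1, h2, h3]
  have h4 : ∑ i, ∑ j, (if i ≤ j then (if i = j then f i j else 2 * f i j) else 0) =
      ∑ i, ∑ j, (if j ≤ i then (if i = j then f i j else 2 * f i j) else 0) := by
    rw [Finset.sum_comm]
    refine Finset.sum_congr rfl fun i _ => Finset.sum_congr rfl fun j _ => ?_
    rw [hf i j]; simp only [eq_comm]
  have h5 : ∑ i, ∑ j, (if i ≤ j then (if i = j then f i j else 2 * f i j) else 0) +
      ∑ i, ∑ j, (if j ≤ i then (if i = j then f i j else 2 * f i j) else 0) =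
      2 * ∑ i, ∑ j, f i j := by
    simp only [← Finset.sum_add_distrib, Finset.mul_sum]
    refine Finset.sum_congr rfl fun i _ => Finset.sum_congr rfl fun j _ => ?_
    rcases lt_trichotomy i j with h | h | h
    · simp [h.le, h.ne, h.not_ge]
    · subst h; simp; ring
    · simp [h.le, h.ne', h.not_ge]
  linarith

/-- The lower bound `ℓ_d = (1 / n!) * 2 ^ ((n - d) / 2) / (d ^ 3 * (d + 7) / 8) ^ n`. -/
noncomputable def ell (d : ℕ) : ℝ :=
  1 / ((symDim d).factorial : ℝ) *
    ((2 : ℝ) ^ (((symDim d : ℝ) - (d : ℝ)) / 2) /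
      (1 / 8 * (d : ℝ) ^ 3 * ((d : ℝ) + 7)) ^ symDim d)

end PerfectForms

namespace PerfectForms

/-! If the minimal vectors `x` of a perfect form all satisfy `|x|² ≤ B`, its Voronoi domain is
large. Perfection makes the forms `xxᵗ` span the symmetric matrices, so `n` of them are independent;
the simplex on 0 and these forms scaled to trace 1 lies in the truncated domain. Its volume is
`|det| / n!`, where the determinant is `2^((n-d)/2)` times a nonzero integer, divided by a product
of `n` traces, each at most `B` (`le_volume_phi_image`).

To get `B`, put `S = Q⁻¹` and let `m` be the minimum of `Q`. In coordinates dual to a basis `v_i` of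
`ℤ^d`, a minimal vector `y` has entries `v_i ⬝ y`, and Cauchy–Schwarz bounds their squares by `m *
S[v_i]`. A basis with small `m * ∑ S[v_i]` comes from a Korkine–Zolotarev type induction
(`exists_isUnit_sum_value_le`). Minkowski's theorem for both `S` and `Q` gives `v` with `m * S[v] ≤
d²`. Splitting `v` off leaves a Schur complement whose inverse is a block of the transformed `Q`, so
`m` still bounds the values of that inverse from below. Lifting a vector back costs at most `S[v] /
4`. -/

/-! ### Minkowski bounds for a form and its inverse -/

theorem isSymm_of_posDef {d : ℕ} {Q : Matrix (Fin d) (Fin d) ℝ} (hQ : Q.PosDef) :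
    Q.IsSymm :=
  (Matrix.conjTranspose_eq_transpose_of_trivial Q).symm.trans hQ.isHermitian

theorem value_transpose_mul_self {d : ℕ} (A : Matrix (Fin d) (Fin d) ℝ) (x : Fin d → ℤ) :
    value (Aᵀ * A) x = ∑ i, (A *ᵥ fun j => (x j : ℝ)) i ^ 2 := by
  rw [value, ← Matrix.mulVec_mulVec, Matrix.dotProduct_mulVec, Matrix.vecMul_transpose]
  simp only [dotProduct, sq]

/-- Minkowski's theorem for the image of `ℤ ^ d` under `A` and a cube. -/
theorem exists_abs_mulVec_le {d : ℕ} (hd : 1 ≤ d) (A : Matrix (Fin d) (Fin d) ℝ)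
    (hA : A.det ≠ 0) {r : ℝ} (hr : 0 ≤ r) (hAr : |A.det| ≤ r ^ d) :
    ∃ x : Fin d → ℤ, x ≠ 0 ∧ ∀ i, |(A *ᵥ fun j => (x j : ℝ)) i| ≤ r := by
  have : NeZero d := ⟨by omega⟩
  have hli : LinearIndependent ℝ A.col :=
    Matrix.linearIndependent_cols_of_isUnit ((Matrix.isUnit_iff_isUnit_det A).2 hA.isUnit)
  let b := basisOfLinearIndependentOfCardEqFinrank hli (by simp)
  have hb : (b : Fin d → Fin d → ℝ) = A.col := by simp [b]
  have : Countable (Submodule.span ℤ (Set.range b)).toAddSubgroup :=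
    inferInstanceAs (Countable (Submodule.span ℤ (Set.range b)))
  -- Compactness of the cube allows equality between `2^d * |det A|` and its volume `(2r)^d`.
  obtain ⟨x, hx0, hx⟩ := exists_ne_zero_mem_lattice_of_measure_mul_two_pow_le_measure
    (μ := volume) (s := Metric.closedBall (0 : Fin d → ℝ) r)
    (ZSpan.isAddFundamentalDomain' b volume)
    (by simp) (convex_closedBall _ _) (isCompact_closedBall _ _) (by
      rw [ZSpan.volume_fundamentalDomain, Real.volume_pi_closedBall _ hr, hb]
      have : (Matrix.of A.col).det = A.det := Matrix.det_transpose A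
      rw [this, Module.finrank_fin_fun, Fintype.card_fin, mul_pow, mul_comm (2 ^ d : ℝ),
        ENNReal.ofReal_mul (by positivity), ENNReal.ofReal_pow zero_le_two]
      simp only [ENNReal.ofReal_ofNat]
      gcongr)
  have hxm : (x : Fin d → ℝ) ∈ Submodule.span ℤ (Set.range b) := x.2
  obtain ⟨z, hz⟩ := (Submodule.mem_span_range_iff_exists_fun ℤ).1 hxm
  have hAz : (A *ᵥ fun j => (z j : ℝ)) = x := by
    rw [← hz, hb]
    ext i
    simp [Matrix.mulVec, dotProduct, mul_comm, Matrix.col]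
  refine ⟨z, ?_, fun i => ?_⟩
  · rintro rfl
    apply hx0
    ext1
    rw [← hAz]
    ext i
    simp [Matrix.mulVec, dotProduct]
  · rw [hAz, ← Real.norm_eq_abs]
    exact (norm_le_pi_norm _ i).trans (by simpa using hx)

/-- A positive definite form of determinant `r ^ (2 * d)` takes a value at most `d * r ^ 2`
at a nonzero integral vector. -/
theorem exists_value_le {d : ℕ} (hd : 1 ≤ d) {S : Matrix (Fin d) (Fin d) ℝ} (hS : S.PosDef)
    {r : ℝ} (hr : 0 ≤ r) (hSr : S.det = (r ^ d) ^ 2) :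
    ∃ x : Fin d → ℤ, x ≠ 0 ∧ value S x ≤ d * r ^ 2 := by
  obtain ⟨A, hA⟩ : ∃ A : Matrix (Fin d) (Fin d) ℝ, S = Aᵀ * A := by
    open scoped MatrixOrder in
    obtain ⟨A, hA⟩ := CStarAlgebra.nonneg_iff_eq_star_mul_self.1
      (Matrix.nonneg_iff_posSemidef.2 hS.posSemidef)
    exact ⟨A, by simpa [Matrix.star_eq_conjTranspose] using hA⟩
  have hdet : S.det = A.det ^ 2 := by rw [hA, Matrix.det_mul, Matrix.det_transpose, sq]
  have hA0 : A.det ≠ 0 := fun h => hS.det_pos.ne' (by simp [hdet, h])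
  obtain ⟨x, hx0, hx⟩ := exists_abs_mulVec_le hd A hA0 hr
    (le_of_eq (by
      rw [← abs_of_nonneg (pow_nonneg hr d)]
      exact (sq_eq_sq_iff_abs_eq_abs _ _).1 (hdet ▸ hSr)))
  refine ⟨x, hx0, ?_⟩
  rw [hA, value_transpose_mul_self]
  calc ∑ i, (A *ᵥ fun j => (x j : ℝ)) i ^ 2 ≤ ∑ _i : Fin d, r ^ 2 :=
        Finset.sum_le_sum fun i _ => sq_le_sq' (abs_le.1 (hx i)).1 (abs_le.1 (hx i)).2
    _ = d * r ^ 2 := by simp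

/-- The product of the minima of a positive definite form and of its inverse is at most `d ^ 2`. -/
theorem exists_mul_value_le_sq {d : ℕ} (hd : 1 ≤ d) {S Q : Matrix (Fin d) (Fin d) ℝ}
    (hS : S.PosDef) (hQ : Q.PosDef) (hSQ : S * Q = 1) {m : ℝ}
    (hm : ∀ x : Fin d → ℤ, x ≠ 0 → m ≤ value Q x) :
    ∃ x : Fin d → ℤ, x ≠ 0 ∧ m * value S x ≤ (d : ℝ) ^ 2 := by
  have hd0 : d ≠ 0 := by omega
  -- With this `r` the bounds for `S` and `Q` are `d * r²` and `d * r⁻²`, so the determinants cancel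
  -- in the product.
  set r : ℝ := (√S.det) ^ ((d : ℝ)⁻¹) with hrdef
  have hr : 0 < r := Real.rpow_pos_of_pos (Real.sqrt_pos.2 hS.det_pos) _
  have hrS : S.det = (r ^ d) ^ 2 := by
    rw [Real.rpow_inv_natCast_pow (Real.sqrt_nonneg _) hd0, Real.sq_sqrt hS.det_pos.le]
  have hdet : S.det * Q.det = 1 := by rw [← Matrix.det_mul, hSQ, Matrix.det_one]
  have hrQ : Q.det = ((r⁻¹) ^ d) ^ 2 := by
    rw [inv_pow, inv_pow, ← hrS]
    exact eq_inv_of_mul_eq_one_right hdet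
  obtain ⟨x, hx0, hx⟩ := exists_value_le hd hS hr.le hrS
  obtain ⟨y, hy0, hy⟩ := exists_value_le hd hQ (inv_pos.2 hr).le hrQ
  refine ⟨x, hx0, ?_⟩
  have hvx : 0 ≤ value S x := hS.posSemidef.dotProduct_mulVec_nonneg _
  calc m * value S x ≤ (d * r⁻¹ ^ 2) * value S x :=
        mul_le_mul_of_nonneg_right ((hm y hy0).trans hy) hvx
    _ ≤ (d * r⁻¹ ^ 2) * (d * r ^ 2) := by gcongr
    _ = (d : ℝ) ^ 2 := by field_simp

/-! ### Primitive vectors and unimodular substitutions -/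

theorem value_smul {d : ℕ} (Q : Matrix (Fin d) (Fin d) ℝ) (k : ℤ) (x : Fin d → ℤ) :
    value Q (k • x) = (k : ℝ) ^ 2 * value Q x := by
  have : (fun i => ((k • x) i : ℝ)) = (k : ℝ) • fun i => (x i : ℝ) := by ext; simp
  rw [value, this, Matrix.mulVec_smul, dotProduct_smul, smul_dotProduct, value]
  simp only [smul_eq_mul]; ring

/-- Every nonzero integral vector is a multiple of a member of a basis of `ℤ ^ d`. -/
theorem exists_basis_smul_eq {d : ℕ} {v : Fin (d + 1) → ℤ} (hv : v ≠ 0) :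
    ∃ (b : Module.Basis (Fin (d + 1)) ℤ (Fin (d + 1) → ℤ)) (k : ℤ), v = k • b 0 := by
  obtain ⟨n, s⟩ := Submodule.smithNormalForm (Pi.basisFun ℤ (Fin (d + 1)))
    (Submodule.span ℤ {v})
  -- The Smith form of the rank one lattice `ℤv` has a single basis vector, a multiple of a member
  -- of a basis of `ℤ^(d+1)`.
  have hn : n = 1 := by
    have h := Module.finrank_eq_card_basis
      (s.bN.map (LinearEquiv.toSpanNonzeroSingleton ℤ _ v hv).symm)
    simpa using h.symm
  subst hn
  have hv' : v ∈ Submodule.span ℤ {v} := Submodule.mem_span_singleton_self v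
  have h := congrArg Subtype.val (s.bN.sum_repr ⟨v, hv'⟩)
  simp only [Fin.sum_univ_one, Submodule.coe_smul, s.snf] at h
  refine ⟨s.bM.reindex (Equiv.swap (s.f 0) 0), s.bN.repr ⟨v, hv'⟩ 0 * s.a 0, ?_⟩
  rw [mul_smul, Module.Basis.reindex_apply, Equiv.symm_swap, Equiv.swap_apply_right, h]

/-- Every nonzero integral vector can be replaced by the first column of a unimodular matrix
without increasing the value of a positive semidefinite form. -/
theorem exists_isUnit_value_le {d : ℕ} {S : Matrix (Fin (d + 1)) (Fin (d + 1)) ℝ}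
    (hS : S.PosSemidef) {v : Fin (d + 1) → ℤ} (hv : v ≠ 0) :
    ∃ W : Matrix (Fin (d + 1)) (Fin (d + 1)) ℤ, IsUnit W.det ∧ value S (W.col 0) ≤ value S v := by
  obtain ⟨b, k, hk⟩ := exists_basis_smul_eq hv
  let := (Pi.basisFun ℤ (Fin (d + 1))).invertibleToMatrix b
  refine ⟨(Pi.basisFun ℤ (Fin (d + 1))).toMatrix b, ?_, ?_⟩
  · exact (Matrix.isUnit_iff_isUnit_det _).1 (isUnit_of_invertible _)
  · have hcol : ((Pi.basisFun ℤ (Fin (d + 1))).toMatrix b).col 0 = b 0 := by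
      ext i; simp [Module.Basis.toMatrix_apply, Matrix.col]
    have hk0 : k ≠ 0 := by rintro rfl; simp [hk] at hv
    have hk1 : (1 : ℝ) ≤ (k : ℝ) ^ 2 := by
      exact_mod_cast Int.one_le_abs (pow_ne_zero 2 hk0) |>.trans_eq (abs_of_nonneg (sq_nonneg k))
    have h0 : 0 ≤ value S (b 0) := hS.dotProduct_mulVec_nonneg _
    rw [hcol, hk, value_smul]
    nlinarith

theorem intCast_mulVec {d : ℕ} (W : Matrix (Fin d) (Fin d) ℤ) (x : Fin d → ℤ) :
    (fun i => ((W *ᵥ x) i : ℝ)) = W.map (Int.cast : ℤ → ℝ) *ᵥ fun i => (x i : ℝ) := by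
  ext i
  simp [Matrix.mulVec, dotProduct]

theorem value_conj {d : ℕ} (Q : Matrix (Fin d) (Fin d) ℝ) (W : Matrix (Fin d) (Fin d) ℤ)
    (x : Fin d → ℤ) :
    value ((W.map (Int.cast : ℤ → ℝ))ᵀ * Q * W.map (Int.cast : ℤ → ℝ)) x = value Q (W *ᵥ x) := by
  rw [value, value, intCast_mulVec, ← Matrix.mulVec_mulVec, ← Matrix.mulVec_mulVec,
    Matrix.dotProduct_mulVec, Matrix.vecMul_transpose]

theorem map_intCast_mul_eq_one {d : ℕ} {V W : Matrix (Fin d) (Fin d) ℤ} (h : V * W = 1) :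
    V.map (Int.cast : ℤ → ℝ) * W.map (Int.cast : ℤ → ℝ) = 1 := by
  have := congrArg (fun M => M.map (Int.castRingHom ℝ)) h
  rw [Matrix.map_mul, Matrix.map_one _ (map_zero _) (map_one _)] at this
  exact this

theorem posDef_conj {d : ℕ} {Q : Matrix (Fin d) (Fin d) ℝ} (hQ : Q.PosDef)
    {W : Matrix (Fin d) (Fin d) ℤ} (hW : IsUnit W.det) :
    ((W.map (Int.cast : ℤ → ℝ))ᵀ * Q * W.map (Int.cast : ℤ → ℝ)).PosDef := by
  have h := map_intCast_mul_eq_one (Matrix.nonsing_inv_mul W hW)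
  refine hQ.conjTranspose_mul_mul_same (B := W.map (Int.cast : ℤ → ℝ)) fun x y hxy => ?_
  have := congrArg (fun z => (W⁻¹.map (Int.cast : ℤ → ℝ)) *ᵥ z) hxy
  simpa [Matrix.mulVec_mulVec, h] using this

/-! ### Schur complements -/

/-- The Schur complement of the upper left entry. -/
noncomputable def schur {d : ℕ} (S : Matrix (Fin (d + 1)) (Fin (d + 1)) ℝ) :
    Matrix (Fin d) (Fin d) ℝ :=
  Matrix.of fun i j => S i.succ j.succ - S i.succ 0 * S 0 j.succ / S 0 0

/-- Completion of the square in the first variable. -/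
theorem dotProduct_mulVec_eq_schur {d : ℕ} {S : Matrix (Fin (d + 1)) (Fin (d + 1)) ℝ}
    (hS : S.IsSymm) (h0 : S 0 0 ≠ 0) (t : ℝ) (x : Fin d → ℝ) :
    (Fin.cons t x : Fin (d + 1) → ℝ) ⬝ᵥ (S *ᵥ (Fin.cons t x : Fin (d + 1) → ℝ)) =
      S 0 0 * (t + (∑ j, S 0 j.succ * x j) / S 0 0) ^ 2 + x ⬝ᵥ (schur S *ᵥ x) := by
  have hsymm : ∀ i : Fin d, S i.succ 0 = S 0 i.succ := fun i => hS.apply _ _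
  have h1 : x ⬝ᵥ (schur S *ᵥ x) = (∑ i, x i * ∑ j, S i.succ j.succ * x j) -
      (∑ j, S 0 j.succ * x j) ^ 2 / S 0 0 := by
    simp only [dotProduct, Matrix.mulVec, schur, Matrix.of_apply, sub_mul, Finset.sum_sub_distrib,
      mul_sub, hsymm]
    congr 1
    rw [sq, Finset.sum_mul, Finset.sum_div]
    refine Finset.sum_congr rfl fun i _ => ?_
    rw [Finset.mul_sum, Finset.mul_sum, Finset.sum_div]
    exact Finset.sum_congr rfl fun j _ => by ring
  have h2 : (∑ i, x i * (S i.succ 0 * t + ∑ j, S i.succ j.succ * x j)) =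
      t * (∑ j, S 0 j.succ * x j) + ∑ i, x i * ∑ j, S i.succ j.succ * x j := by
    simp only [mul_add, Finset.sum_add_distrib, hsymm]
    rw [Finset.mul_sum]
    congr 1
    exact Finset.sum_congr rfl fun j _ => by ring
  rw [h1]
  simp only [dotProduct, Matrix.mulVec, Fin.sum_univ_succ, Fin.cons_zero, Fin.cons_succ]
  rw [h2]
  field_simp
  ring

theorem posDef_schur {d : ℕ} {S : Matrix (Fin (d + 1)) (Fin (d + 1)) ℝ} (hS : S.PosDef) :
    (schur S).PosDef := by
  have hsymm : S.IsSymm := isSymm_of_posDef hS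
  have h0 : S 0 0 ≠ 0 := hS.diag_pos.ne'
  refine Matrix.PosDef.of_dotProduct_mulVec_pos ?_ fun x hx => ?_
  · ext i j
    simp only [schur, Matrix.conjTranspose_apply, Matrix.of_apply, star_trivial]
    rw [hsymm.apply i.succ j.succ, hsymm.apply 0 i.succ, hsymm.apply j.succ 0, mul_comm]
  · have hc : (Fin.cons (-((∑ j, S 0 j.succ * x j) / S 0 0)) x : Fin (d + 1) → ℝ) ≠ 0 := by
      intro h
      apply hx
      ext i
      simpa using congrFun h i.succ
    have := hS.dotProduct_mulVec_pos hc
    rw [star_trivial, dotProduct_mulVec_eq_schur hsymm h0] at this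
    simpa using this

/-- Block inversion: row 0 of `S * Q = 1` eliminates `Q 0 j` from the other rows. It lets the
induction carry a form and its inverse together. -/
theorem schur_mul_submatrix {d : ℕ} {S Q : Matrix (Fin (d + 1)) (Fin (d + 1)) ℝ}
    (h0 : S 0 0 ≠ 0) (h : S * Q = 1) : schur S * Q.submatrix Fin.succ Fin.succ = 1 := by
  ext i j
  have h1 := congrFun (congrFun h i.succ) j.succ
  have h2 := congrFun (congrFun h 0) j.succ
  simp only [Matrix.mul_apply, Fin.sum_univ_succ] at h1 h2
  rw [Matrix.one_apply_ne (Fin.succ_ne_zero j).symm] at h2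
  have h3 : ((1 : Matrix (Fin (d + 1)) (Fin (d + 1)) ℝ) i.succ j.succ) =
      (1 : Matrix (Fin d) (Fin d) ℝ) i j := by
    simp [Matrix.one_apply]
  rw [h3] at h1
  simp only [Matrix.mul_apply, schur, Matrix.of_apply, Matrix.submatrix_apply, sub_mul,
    Finset.sum_sub_distrib]
  have h4 : ∑ k : Fin d, S i.succ 0 * S 0 k.succ / S 0 0 * Q k.succ j.succ =
      S i.succ 0 / S 0 0 * ∑ k : Fin d, S 0 k.succ * Q k.succ j.succ := by
    rw [Finset.mul_sum]
    exact Finset.sum_congr rfl fun k _ => by ring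
  rw [h4, ← h1, eq_neg_of_add_eq_zero_right h2]
  field_simp
  ring

/-- Prepending the first unit vector to a unimodular matrix, with first row `t` otherwise. -/
def consBlock {d : ℕ} (t : Fin d → ℤ) (V : Matrix (Fin d) (Fin d) ℤ) :
    Matrix (Fin (d + 1)) (Fin (d + 1)) ℤ :=
  Matrix.of (Fin.cons (Fin.cons 1 t) fun i => Fin.cons 0 (V i))

theorem det_consBlock {d : ℕ} (t : Fin d → ℤ) (V : Matrix (Fin d) (Fin d) ℤ) :
    (consBlock t V).det = V.det := by
  rw [Matrix.det_succ_column_zero, Fin.sum_univ_succ]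
  simp [consBlock]
  rfl

theorem consBlock_col_zero {d : ℕ} (t : Fin d → ℤ) (V : Matrix (Fin d) (Fin d) ℤ) :
    (consBlock t V).col 0 = Pi.single 0 1 := by
  ext i
  refine Fin.cases ?_ (fun i => ?_) i <;> simp [consBlock, Matrix.col]

theorem consBlock_col_succ {d : ℕ} (t : Fin d → ℤ) (V : Matrix (Fin d) (Fin d) ℤ) (j : Fin d) :
    (consBlock t V).col j.succ = Fin.cons (t j) (V.col j) := by
  ext i
  refine Fin.cases ?_ (fun i => ?_) i <;> simp [consBlock, Matrix.col]

/-- Some first coordinate makes the value at `(t, x)` close to that of the Schur complement. -/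
theorem exists_value_cons_le {d : ℕ} {S : Matrix (Fin (d + 1)) (Fin (d + 1)) ℝ} (hS : S.PosDef)
    (x : Fin d → ℤ) : ∃ t : ℤ, value S (Fin.cons t x) ≤ S 0 0 / 4 + value (schur S) x := by
  have hsymm : S.IsSymm := isSymm_of_posDef hS
  have h0 : 0 < S 0 0 := hS.diag_pos
  set c : ℝ := (∑ j, S 0 j.succ * (x j : ℝ)) / S 0 0
  -- Rounding leaves `|t + c| ≤ 1/2`, hence the quarter of `S 0 0`.
  refine ⟨-round c, ?_⟩
  have hcast : (fun i => ((Fin.cons (-round c) x : Fin (d + 1) → ℤ) i : ℝ)) =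
      Fin.cons (((-round c : ℤ) : ℝ)) fun i => (x i : ℝ) := by
    ext i
    refine Fin.cases ?_ (fun i => ?_) i <;> simp
  rw [value, hcast, dotProduct_mulVec_eq_schur hsymm h0.ne', value]
  have h1 := abs_le.1 (abs_sub_round c)
  have h2 : (((-round c : ℤ) : ℝ) + c) ^ 2 ≤ 1 / 4 := by
    push_cast
    nlinarith [h1.1, h1.2]
  have := mul_le_mul_of_nonneg_left h2 h0.le
  linarith

theorem value_single {d : ℕ} (S : Matrix (Fin d) (Fin d) ℝ) (i : Fin d) :
    value S (Pi.single i 1) = S i i := by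
  have : (fun j => ((Pi.single i 1 : Fin d → ℤ) j : ℝ)) = Pi.single i 1 := by
    ext j
    by_cases h : j = i
    · subst h; simp
    · simp [h]
  rw [value, this]
  simp

/-! ### Reduction by induction on the dimension -/

/-- A form whose inverse has minimum at least `m` has a basis that is short on average. -/
theorem exists_isUnit_sum_value_le {d : ℕ} {S Q : Matrix (Fin d) (Fin d) ℝ} (hS : S.PosDef)
    (hQ : Q.PosDef) (hSQ : S * Q = 1) {m : ℝ} (hm0 : 0 ≤ m)
    (hm : ∀ x : Fin d → ℤ, x ≠ 0 → m ≤ value Q x) :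
    ∃ V : Matrix (Fin d) (Fin d) ℤ, IsUnit V.det ∧
      m * ∑ i, value S (V.col i) ≤ (d : ℝ) * (d + 1) * (d ^ 2 + 5 * d + 2) / 16 := by
  induction d generalizing m with
  | zero => exact ⟨1, by simp, by simp⟩
  | succ d ih =>
    obtain ⟨v, hv0, hv⟩ := exists_mul_value_le_sq (by omega) hS hQ hSQ hm
    obtain ⟨W, hW, hWv⟩ := exists_isUnit_value_le hS.posSemidef hv0
    have hWW := Matrix.mul_nonsing_inv W hW
    have hW' : IsUnit (W⁻¹)ᵀ.det := by
      rw [Matrix.det_transpose]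
      exact Matrix.isUnit_nonsing_inv_det W hW
    -- Transforming `S` by `W` and `Q` by the inverse transpose keeps the two forms inverse to each
    -- other and makes the short vector the first unit vector.
    set S₁ := (W.map (Int.cast : ℤ → ℝ))ᵀ * S * W.map (Int.cast : ℤ → ℝ) with hS₁def
    set Q₁ := ((W⁻¹)ᵀ.map (Int.cast : ℤ → ℝ))ᵀ * Q * (W⁻¹)ᵀ.map (Int.cast : ℤ → ℝ) with hQ₁def
    have hS₁ : S₁.PosDef := posDef_conj hS hW
    have hQ₁ : Q₁.PosDef := posDef_conj hQ hW'
    have hSQ₁ : S₁ * Q₁ = 1 := by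
      have h1 := map_intCast_mul_eq_one hWW
      have h2 := congrArg Matrix.transpose (map_intCast_mul_eq_one (Matrix.nonsing_inv_mul W hW))
      rw [Matrix.transpose_mul, Matrix.transpose_one] at h2
      rw [hS₁def, hQ₁def, Matrix.transpose_map, Matrix.transpose_transpose]
      calc _ = (W.map (Int.cast : ℤ → ℝ))ᵀ * (S * (W.map (Int.cast : ℤ → ℝ) *
            W⁻¹.map (Int.cast : ℤ → ℝ)) * Q) * (W⁻¹.map (Int.cast : ℤ → ℝ))ᵀ := by
              simp only [Matrix.mul_assoc]
        _ = 1 := by rw [h1, Matrix.mul_one, hSQ, Matrix.mul_one, h2]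
    have h0 : 0 < S₁ 0 0 := hS₁.diag_pos
    have hcol : ∀ x : Fin (d + 1) → ℤ, value S₁ x = value S (W *ᵥ x) := value_conj S W
    have hm1 : m * S₁ 0 0 ≤ ((d : ℝ) + 1) ^ 2 := by
      have : S₁ 0 0 = value S (W.col 0) := by
        rw [← value_single S₁ 0, hcol, Matrix.mulVec_single_one]
      rw [this]
      push_cast at hv
      exact (mul_le_mul_of_nonneg_left hWv hm0).trans hv
    obtain ⟨V, hV, hVm⟩ := ih (posDef_schur hS₁)
      (hQ₁.submatrix (Fin.succ_injective d)) (schur_mul_submatrix h0.ne' hSQ₁) hm0 (by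
        intro x hx
        -- The lower right block of `Q₁` takes at `x` the value of `Q₁` at `(0, x)`, so `m` remains
        -- a lower bound.
        have hne : (W⁻¹)ᵀ *ᵥ (Fin.cons 0 x : Fin (d + 1) → ℤ) ≠ 0 := by
          intro h
          apply hx
          have h' := Matrix.eq_zero_of_mulVec_eq_zero hW'.ne_zero h
          ext i
          simpa using congrFun h' i.succ
        have := hm _ hne
        rw [← value_conj, ← hQ₁def] at this
        refine this.trans_eq ?_
        simp [value, dotProduct, Matrix.mulVec, Fin.sum_univ_succ])
    choose t ht using fun j => exists_value_cons_le hS₁ (V.col j)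
    refine ⟨W * consBlock t V, by rw [Matrix.det_mul, det_consBlock]; exact hW.mul hV, ?_⟩
    have hval : ∀ j, value S ((W * consBlock t V).col j) = value S₁ ((consBlock t V).col j) := by
      intro j
      rw [hcol, ← Matrix.mulVec_single_one, ← Matrix.mulVec_single_one, Matrix.mulVec_mulVec]
    simp only [hval, Fin.sum_univ_succ, consBlock_col_zero, consBlock_col_succ, value_single]
    have hsum : ∑ j, value S₁ (Fin.cons (t j) (V.col j)) ≤
        d * (S₁ 0 0 / 4) + ∑ j, value (schur S₁) (V.col j) := by
      refine (Finset.sum_le_sum fun j _ => ht j).trans_eq ?_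
      simp [Finset.sum_add_distrib]
    have hd0 : (0 : ℝ) ≤ d := by positivity
    calc m * (S₁ 0 0 + ∑ j, value S₁ (Fin.cons (t j) (V.col j)))
        ≤ m * (S₁ 0 0 + (d * (S₁ 0 0 / 4) + ∑ j, value (schur S₁) (V.col j))) := by gcongr
      _ = m * S₁ 0 0 * (1 + d / 4) + m * ∑ j, value (schur S₁) (V.col j) := by ring
      -- The bound is the sum of `k² * (k + 3) / 4` over `1 ≤ k ≤ d + 1`; this is its last term plus
      -- the rest.
      _ ≤ ((d : ℝ) + 1) ^ 2 * (1 + d / 4) + (d : ℝ) * (d + 1) * (d ^ 2 + 5 * d + 2) / 16 := by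
        gcongr
      _ = _ := by push_cast; ring

/-! ### Volumes of simplices -/

/-- The standard simplex has volume at least `1 / n!`: its reflections cover the open unit ball
of the `ℓ¹` norm. -/
theorem ofReal_inv_factorial_le_volume_simplex (n : ℕ) :
    ENNReal.ofReal (1 / n.factorial) ≤
      volume {t : Fin n → ℝ | (∀ i, 0 ≤ t i) ∧ ∑ i, t i ≤ 1} := by
  set Δ : Set (Fin n → ℝ) := {t | (∀ i, 0 ≤ t i) ∧ ∑ i, t i ≤ 1}
  let sgn : (Fin n → Bool) → Fin n → ℝ := fun ε i => if ε i then 1 else -1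
  have hball : volume {x : Fin n → ℝ | ∑ i, |x i| ^ (1 : ℝ) < 1} =
      ENNReal.ofReal (2 ^ n / n.factorial) := by
    -- At exponent 1 the formula has the Gamma values `Γ(2) = 1!` and `Γ(n + 1) = n!`.
    rw [MeasureTheory.volume_sum_rpow_lt_one (Fin n) le_rfl, div_one, div_one, Fintype.card_fin,
      Real.Gamma_nat_eq_factorial, show (1 : ℝ) + 1 = ((1 : ℕ) : ℝ) + 1 by simp,
      Real.Gamma_nat_eq_factorial]
    simp
  have hsub : {x : Fin n → ℝ | ∑ i, |x i| ^ (1 : ℝ) < 1} ⊆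
      ⋃ ε : Fin n → Bool, Matrix.toLin' (Matrix.diagonal (sgn ε)) '' Δ := by
    intro x hx
    simp only [Real.rpow_one, Set.mem_ofPred_eq] at hx
    refine Set.mem_iUnion.2 ⟨fun i => decide (0 ≤ x i), fun i => |x i|,
      ⟨fun i => abs_nonneg _, hx.le⟩, ?_⟩
    ext i
    rw [Matrix.toLin'_apply, Matrix.mulVec_diagonal]
    by_cases h : 0 ≤ x i
    · simp [sgn, h, abs_of_nonneg h]
    · simp [sgn, h, abs_of_neg (not_le.1 h)]
  have himage : ∀ ε : Fin n → Bool,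
      volume (Matrix.toLin' (Matrix.diagonal (sgn ε)) '' Δ) = volume Δ := by
    intro ε
    have h1 : ∀ i, |sgn ε i| = 1 := fun i => by simp only [sgn]; split_ifs <;> simp
    rw [Measure.addHaar_image_linearMap, LinearMap.det_toLin', Matrix.det_diagonal,
      Finset.abs_prod]
    simp [h1]
  have hle : ENNReal.ofReal (2 ^ n / n.factorial) ≤ 2 ^ n * volume Δ := by
    rw [← hball]
    refine (measure_mono hsub).trans ((measure_iUnion_fintype_le _ _).trans_eq ?_)
    simp [himage]
  have h2 : ENNReal.ofReal (2 ^ n / n.factorial) = 2 ^ n * ENNReal.ofReal (1 / n.factorial) := by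
    rw [← mul_one_div, ENNReal.ofReal_mul (by positivity), ENNReal.ofReal_pow zero_le_two,
      ENNReal.ofReal_ofNat]
  rw [h2] at hle
  exact (ENNReal.mul_le_mul_iff_right (by simp) (by simp)).1 hle

theorem ofReal_det_div_factorial_le_volume {n : ℕ} (A : Matrix (Fin n) (Fin n) ℝ)
    {K : Set (EuclideanSpace ℝ (Fin n))}
    (hK : ∀ t : Fin n → ℝ, (∀ i, 0 ≤ t i) → ∑ i, t i ≤ 1 → WithLp.toLp 2 (A *ᵥ t) ∈ K) :
    ENNReal.ofReal (1 / n.factorial * |A.det|) ≤ volume K := by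
  rw [← (EuclideanSpace.volume_preserving_symm_measurableEquiv_toLp
    (Fin n)).symm.measure_preimage_equiv]
  calc _ = ENNReal.ofReal |A.det| * ENNReal.ofReal (1 / n.factorial) := by
        rw [mul_comm, ENNReal.ofReal_mul (abs_nonneg _)]
    _ ≤ ENNReal.ofReal |A.det| * volume {t : Fin n → ℝ | (∀ i, 0 ≤ t i) ∧ ∑ i, t i ≤ 1} :=
        mul_le_mul_right (ofReal_inv_factorial_le_volume_simplex n) _
    _ = volume (Matrix.toLin' A '' {t : Fin n → ℝ | (∀ i, 0 ≤ t i) ∧ ∑ i, t i ≤ 1}) := by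
        rw [Measure.addHaar_image_linearMap, LinearMap.det_toLin']
    _ ≤ _ := by
        refine measure_mono ?_
        rintro _ ⟨t, ht, rfl⟩
        exact hK t ht.1 ht.2

/-! ### Coordinates of symmetric matrices and the volume of a Voronoi domain -/

section Phi

variable {d : ℕ} (e : UpperPairs d ≃ Fin (symDim d))

/-- The factor `1` or `√2` of a coordinate of `phi`. -/
noncomputable def phiFactor (p : UpperPairs d) : ℝ := if p.1.1 = p.1.2 then 1 else √2

theorem phiFactor_ne_zero (p : UpperPairs d) : phiFactor p ≠ 0 := by
  unfold phiFactor
  split_ifs <;> simp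

theorem phi_apply (P : Matrix (Fin d) (Fin d) ℝ) (k : Fin (symDim d)) :
    phi e P k = phiFactor (e.symm k) * P (e.symm k).1.1 (e.symm k).1.2 := by
  simp only [phi, phiFactor]
  split_ifs <;> simp

/-- Lets a vector orthogonal to all the `xxᵗ` be read as a symmetric matrix. -/
theorem exists_isSymm_phi_eq (y : EuclideanSpace ℝ (Fin (symDim d))) :
    ∃ R : Matrix (Fin d) (Fin d) ℝ, R.IsSymm ∧ phi e R = y := by
  let p : Fin d → Fin d → UpperPairs d := fun i j => ⟨(min i j, max i j), min_le_max⟩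
  have hp : ∀ q : UpperPairs d, p q.1.1 q.1.2 = q := by
    rintro ⟨⟨i, j⟩, h⟩
    simp only at h
    simp [p, h]
  refine ⟨Matrix.of fun i j => y (e (p i j)) / phiFactor (p i j), ?_, ?_⟩
  · ext i j
    simp [p, min_comm, max_comm]
  · ext k
    rw [phi_apply, Matrix.of_apply, hp, Equiv.apply_symm_apply,
      mul_div_cancel₀ _ (phiFactor_ne_zero _)]

theorem isSymm_rankOne (x : Fin d → ℤ) : (rankOne x).IsSymm := by
  ext i j
  simp [rankOne, mul_comm]

theorem trace_rankOne (x : Fin d → ℤ) : (rankOne x).trace = ∑ i, (x i : ℝ) ^ 2 := by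
  simp [Matrix.trace, rankOne, sq]

theorem trace_transpose_mul_rankOne (R : Matrix (Fin d) (Fin d) ℝ) (x : Fin d → ℤ) :
    (Rᵀ * rankOne x).trace = value R x := by
  simp only [Matrix.trace, Matrix.diag, Matrix.mul_apply, rankOne, value, dotProduct,
    Matrix.mulVec, Matrix.transpose_apply, Matrix.of_apply, Finset.mul_sum]
  rw [Finset.sum_comm]
  exact Finset.sum_congr rfl fun i _ => Finset.sum_congr rfl fun j _ => by ring

theorem value_add (P R : Matrix (Fin d) (Fin d) ℝ) (x : Fin d → ℤ) :
    value (P + R) x = value P x + value R x := by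
  simp only [value, Matrix.add_mulVec, dotProduct_add]

/-- The rank one forms of the minimal vectors of a perfect form span the symmetric matrices. -/
theorem span_phi_rankOne_eq_top {Q : Matrix (Fin d) (Fin d) ℝ} (hQ : IsPerfect Q) :
    Submodule.span ℝ ((fun x => phi e (rankOne x)) '' minVectors Q) = ⊤ := by
  rw [← Submodule.orthogonal_eq_bot_iff, Submodule.eq_bot_iff]
  intro y hy
  obtain ⟨R, hR, rfl⟩ := exists_isSymm_phi_eq e y
  have h0 : ∀ x ∈ minVectors Q, value R x = 0 := by
    intro x hx
    rw [← trace_transpose_mul_rankOne, ← inner_phi e R _ hR (isSymm_rankOne x)]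
    have hm : phi e (rankOne x) ∈
        Submodule.span ℝ ((fun x => phi e (rankOne x)) '' minVectors Q) :=
      Submodule.subset_span ⟨x, hx, rfl⟩
    exact Submodule.inner_left_of_mem_orthogonal hm hy
  -- Adding `R` leaves the values at all minimal vectors unchanged, so perfection forces `R = 0`.
  have hRQ := hQ.2 (Q + R) ((isSymm_of_posDef hQ.1).add hR) fun x hx => by
    rw [value_add, h0 x hx, add_zero]
    exact hx
  rw [add_eq_left.1 hRQ]
  ext k
  simp [phi_apply]

theorem exists_linearIndependent_phi_rankOne {Q : Matrix (Fin d) (Fin d) ℝ} (hQ : IsPerfect Q) :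
    ∃ x : Fin (symDim d) → Fin d → ℤ, (∀ k, x k ∈ minVectors Q) ∧
      LinearIndependent ℝ fun k => phi e (rankOne (x k)) := by
  have h := Submodule.exists_fun_fin_finrank_span_eq ℝ
    ((fun x => phi e (rankOne x)) '' minVectors Q)
  rw [span_phi_rankOne_eq_top e hQ, finrank_top, finrank_euclideanSpace_fin] at h
  obtain ⟨f, hf, -, hli⟩ := h
  choose x hx hxf using hf
  exact ⟨x, hx, by simpa only [hxf] using hli⟩

theorem prod_phiFactor : ∏ k, phiFactor (e.symm k) =
    (2 : ℝ) ^ (((symDim d : ℝ) - d) / 2) := by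
  rw [e.symm.prod_comp phiFactor]
  simp only [phiFactor]
  rw [Finset.prod_ite, Finset.prod_const_one, one_mul, Finset.prod_const]
  have hdiag : (Finset.univ.filter fun p : UpperPairs d => p.1.1 = p.1.2).card = d := by
    conv_rhs => rw [← Fintype.card_fin d]
    rw [← Fintype.card_subtype]
    exact Fintype.card_congr
      ⟨fun p => p.1.1.1, fun i => ⟨⟨(i, i), le_rfl⟩, rfl⟩, fun p => by
        obtain ⟨⟨⟨i, j⟩, h⟩, h'⟩ := p
        simp only at h'
        subst h'
        rfl, fun i => rfl⟩
  have hcard := Finset.card_filter_add_card_filter_not (s := (Finset.univ : Finset (UpperPairs d)))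
    (fun p => p.1.1 = p.1.2)
  rw [hdiag, Finset.card_univ, card_upperPairs] at hcard
  have hc : (((Finset.univ.filter fun p : UpperPairs d => ¬ p.1.1 = p.1.2).card : ℕ) : ℝ) =
      (symDim d : ℝ) - d := by
    rw [← hcard]; push_cast; ring
  rw [Real.sqrt_eq_rpow, ← Real.rpow_natCast, ← Real.rpow_mul zero_le_two, hc]
  congr 1
  ring

/-- The inequality is preserved by non-negative combinations, so the generators suffice. It makes
the truncated domain bounded. -/
theorem abs_le_trace_of_mem_voronoiDomain {Q P : Matrix (Fin d) (Fin d) ℝ}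
    (hP : P ∈ voronoiDomain Q) (i j : Fin d) : |P i j| ≤ P.trace := by
  refine Submodule.span_induction ?_ (by simp) ?_ ?_ hP
  · rintro _ ⟨x, -, rfl⟩
    rw [trace_rankOne]
    have h1 : ∀ k, |(x k : ℝ)| ^ 2 ≤ ∑ l, (x l : ℝ) ^ 2 := fun k => by
      rw [sq_abs]
      exact Finset.single_le_sum (f := fun l => (x l : ℝ) ^ 2) (fun l _ => sq_nonneg _)
        (Finset.mem_univ k)
    simp only [rankOne, Matrix.of_apply, abs_mul]
    -- Arithmetic–geometric mean: `|x i| * |x j| ≤ (x i² + x j²) / 2`.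
    nlinarith [h1 i, h1 j, sq_nonneg (|(x i : ℝ)| - |(x j : ℝ)|)]
  · intro A B _ _ hA hB
    rw [Matrix.trace_add]
    exact (abs_add_le _ _).trans (add_le_add hA hB)
  · intro c A _ hA
    have hc : (0 : ℝ) ≤ c := c.2
    rw [Matrix.trace_smul]
    change |(c : ℝ) * A i j| ≤ (c : ℝ) * A.trace
    rw [abs_mul, abs_of_nonneg hc]
    exact mul_le_mul_of_nonneg_left hA hc

/-- Finiteness matters because the real-valued volume of a set of infinite measure is 0 by
convention. -/
theorem volume_phi_image_lt_top (Q : Matrix (Fin d) (Fin d) ℝ) :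
    volume (phi e '' (voronoiDomain Q ∩ traceHalfSpace d)) < ⊤ := by
  rw [← (EuclideanSpace.volume_preserving_symm_measurableEquiv_toLp _).symm.measure_preimage_equiv]
  refine (measure_mono ?_).trans_lt (measure_closedBall_lt_top (x := (0 : Fin (symDim d) → ℝ))
    (r := √2))
  rintro y ⟨P, ⟨hP, -, htr⟩, hy⟩
  have hy' : ∀ k, y k = phi e P k := fun k => by rw [hy]; rfl
  rw [mem_closedBall_zero_iff, pi_norm_le_iff_of_nonneg (Real.sqrt_nonneg _)]
  intro k
  have h1 : |phiFactor (e.symm k)| ≤ √2 := by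
    unfold phiFactor
    split_ifs
    · simp
    · rw [abs_of_nonneg (Real.sqrt_nonneg _)]
  rw [hy', phi_apply, Real.norm_eq_abs, abs_mul]
  calc _ ≤ √2 * 1 := mul_le_mul h1
        ((abs_le_trace_of_mem_voronoiDomain hP _ _).trans htr) (abs_nonneg _) (Real.sqrt_nonneg _)
    _ = √2 := mul_one _

/-- Pulling the factors `√2` out of the rows leaves an integral matrix, and a nonzero integer has
absolute value at least 1. -/
theorem le_abs_det_phi_rankOne (x : Fin (symDim d) → Fin d → ℤ)
    (hli : LinearIndependent ℝ fun k => phi e (rankOne (x k))) :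
    (2 : ℝ) ^ (((symDim d : ℝ) - d) / 2) ≤
      |(Matrix.of fun i k => phi e (rankOne (x k)) i).det| := by
  set N : Matrix (Fin (symDim d)) (Fin (symDim d)) ℤ :=
    Matrix.of fun i k => x k (e.symm i).1.1 * x k (e.symm i).1.2
  have hM : (Matrix.of fun i k => phi e (rankOne (x k)) i) =
      Matrix.of fun i k => phiFactor (e.symm i) * N.map (Int.cast : ℤ → ℝ) i k := by
    ext i k
    simp [phi_apply, rankOne, N]
  have hdet : (Matrix.of fun i k => phi e (rankOne (x k)) i).det =
      (2 : ℝ) ^ (((symDim d : ℝ) - d) / 2) * (N.det : ℝ) := by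
    rw [hM, Matrix.det_mul_column (fun i => phiFactor (e.symm i)), prod_phiFactor]
    congr 1
    exact ((Int.castRingHom ℝ).map_det N).symm
  have hne : (Matrix.of fun i k => phi e (rankOne (x k)) i).det ≠ 0 := by
    refine ((Matrix.isUnit_iff_isUnit_det _).1
      (Matrix.linearIndependent_cols_iff_isUnit.1 ?_)).ne_zero
    exact hli.map' (WithLp.linearEquiv 2 ℝ (Fin (symDim d) → ℝ)).toLinearMap
      (LinearEquiv.ker _)
  have hN : N.det ≠ 0 := fun h => hne (by rw [hdet, h]; simp)
  rw [hdet, abs_mul, abs_of_pos (Real.rpow_pos_of_pos two_pos _)]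
  refine le_mul_of_one_le_right (Real.rpow_pos_of_pos two_pos _).le ?_
  exact_mod_cast Int.one_le_abs hN

theorem phi_sum_smul {ι : Type*} [Fintype ι] (c : ι → ℝ) (P : ι → Matrix (Fin d) (Fin d) ℝ)
    (k : Fin (symDim d)) : phi e (∑ l, c l • P l) k = ∑ l, c l * phi e (P l) k := by
  simp only [phi_apply, Matrix.sum_apply, Matrix.smul_apply, smul_eq_mul, Finset.mul_sum]
  exact Finset.sum_congr rfl fun l _ => by ring

/-- A perfect form with short minimal vectors has a large Voronoi domain. -/
theorem le_volume_phi_image {Q : Matrix (Fin d) (Fin d) ℝ} (hQ : IsPerfect Q) {B : ℝ}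
    (hB : ∀ x ∈ minVectors Q, ∑ i, (x i : ℝ) ^ 2 ≤ B) :
    1 / ((symDim d).factorial : ℝ) * ((2 : ℝ) ^ (((symDim d : ℝ) - (d : ℝ)) / 2) / B ^ symDim d) ≤
      (volume : Measure (EuclideanSpace ℝ (Fin (symDim d)))).real
        (phi e '' (voronoiDomain Q ∩ traceHalfSpace d)) := by
  obtain ⟨x, hx, hli⟩ := exists_linearIndependent_phi_rankOne e hQ
  set N : Fin (symDim d) → ℝ := fun k => (rankOne (x k)).trace with hN
  have hN0 : ∀ k, 0 < N k := by
    intro k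
    simp only [hN, trace_rankOne]
    -- Trace zero would make `x k` vanish, contrary to linear independence.
    refine lt_of_le_of_ne (Finset.sum_nonneg fun i _ => sq_nonneg _) fun h => hli.ne_zero k ?_
    have h' := (Finset.sum_eq_zero_iff_of_nonneg fun i _ => sq_nonneg _).1 h.symm
    ext l
    have := h' (e.symm l).1.1 (Finset.mem_univ _)
    simp [phi_apply, rankOne, pow_eq_zero_iff two_ne_zero |>.1 this]
  have hNB : ∀ k, N k ≤ B := fun k => by
    simpa only [hN, trace_rankOne] using hB _ (hx k)
  set A : Matrix (Fin (symDim d)) (Fin (symDim d)) ℝ :=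
    Matrix.of fun i k => (N k)⁻¹ * (Matrix.of fun i k => phi e (rankOne (x k)) i) i k with hA
  have hdet : (2 : ℝ) ^ (((symDim d : ℝ) - (d : ℝ)) / 2) / B ^ symDim d ≤ |A.det| := by
    rw [hA, Matrix.det_mul_row, abs_mul, Finset.prod_inv_distrib, div_eq_inv_mul, abs_inv,
      abs_of_pos (Finset.prod_pos fun k _ => hN0 k)]
    refine mul_le_mul ?_ (le_abs_det_phi_rankOne e x hli)
      (Real.rpow_pos_of_pos two_pos _).le (inv_nonneg.2 (Finset.prod_nonneg fun k _ => (hN0 k).le))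
    refine inv_anti₀ (Finset.prod_pos fun k _ => hN0 k) ?_
    refine (Finset.prod_le_prod (fun k _ => (hN0 k).le) fun k _ => hNB k).trans_eq ?_
    simp
  have hvol : ENNReal.ofReal (1 / (symDim d).factorial * |A.det|) ≤
      volume (phi e '' (voronoiDomain Q ∩ traceHalfSpace d)) := by
    refine ofReal_det_div_factorial_le_volume A fun t ht ht1 => ?_
    -- Each `xxᵗ` is scaled to trace 1, so the trace of the sum is `∑ t k ≤ 1`.
    refine ⟨∑ k, (t k * (N k)⁻¹) • rankOne (x k), ⟨?_, ?_, ?_⟩, ?_⟩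
    · refine Submodule.sum_mem _ fun k _ => ?_
      have hc : 0 ≤ t k * (N k)⁻¹ := mul_nonneg (ht k) (inv_nonneg.2 (hN0 k).le)
      exact Submodule.smul_mem _ (⟨_, hc⟩ : NNReal)
        (Submodule.subset_span (Set.mem_image_of_mem _ (hx k)))
    · rw [Matrix.IsSymm, Matrix.transpose_sum]
      refine Finset.sum_congr rfl fun k _ => ?_
      rw [Matrix.transpose_smul, (isSymm_rankOne (x k)).eq]
    · rw [Matrix.trace_sum]
      refine le_of_eq_of_le (Finset.sum_congr rfl fun k _ => ?_) ht1
      rw [Matrix.trace_smul, smul_eq_mul, mul_assoc, inv_mul_cancel₀ (hN0 k).ne', mul_one]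
    · ext i
      rw [phi_sum_smul]
      simp only [Matrix.mulVec, dotProduct, hA, Matrix.of_apply]
      exact Finset.sum_congr rfl fun k _ => by ring
  refine le_trans (mul_le_mul_of_nonneg_left hdet (by positivity)) ?_
  exact (ENNReal.ofReal_le_iff_le_toReal (volume_phi_image_lt_top e Q).ne).1 hvol

end Phi

/-! ### Invariance under arithmetical equivalence -/

theorem arithMin_conj {d : ℕ} (Q : Matrix (Fin d) (Fin d) ℝ) {U : Matrix (Fin d) (Fin d) ℤ}
    (hU : IsUnit U.det) :
    arithMin ((U.map (Int.cast : ℤ → ℝ))ᵀ * Q * U.map (Int.cast : ℤ → ℝ)) = arithMin Q := by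
  unfold arithMin
  congr 1
  ext r
  constructor
  · rintro ⟨x, hx, rfl⟩
    exact ⟨U *ᵥ x, fun h => hx (Matrix.eq_zero_of_mulVec_eq_zero hU.ne_zero h), value_conj Q U x⟩
  · rintro ⟨x, hx, rfl⟩
    refine ⟨U⁻¹ *ᵥ x, fun h => hx ?_, ?_⟩
    · have := congrArg (U *ᵥ ·) h
      simpa [Matrix.mulVec_mulVec, Matrix.mul_nonsing_inv U hU] using this
    · rw [value_conj, Matrix.mulVec_mulVec, Matrix.mul_nonsing_inv U hU, Matrix.one_mulVec]

theorem mem_minVectors_conj {d : ℕ} (Q : Matrix (Fin d) (Fin d) ℝ) {U : Matrix (Fin d) (Fin d) ℤ}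
    (hU : IsUnit U.det) (x : Fin d → ℤ) :
    x ∈ minVectors ((U.map (Int.cast : ℤ → ℝ))ᵀ * Q * U.map (Int.cast : ℤ → ℝ)) ↔
      U *ᵥ x ∈ minVectors Q := by
  simp only [minVectors, Set.mem_ofPred_eq, value_conj, arithMin_conj Q hU]

/-- A competitor `P` is carried back by `U⁻¹` to a competitor of `Q`, which must equal `Q`. -/
theorem IsPerfect.conj {d : ℕ} {Q : Matrix (Fin d) (Fin d) ℝ} (hQ : IsPerfect Q)
    {U : Matrix (Fin d) (Fin d) ℤ} (hU : IsUnit U.det) :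
    IsPerfect ((U.map (Int.cast : ℤ → ℝ))ᵀ * Q * U.map (Int.cast : ℤ → ℝ)) := by
  refine ⟨posDef_conj hQ.1 hU, fun P hP hPx => ?_⟩
  have hinv := map_intCast_mul_eq_one (Matrix.nonsing_inv_mul U hU)
  have hinvt := congrArg Matrix.transpose hinv
  rw [Matrix.transpose_mul, Matrix.transpose_one] at hinvt
  have h := hQ.2 ((U⁻¹.map (Int.cast : ℤ → ℝ))ᵀ * P * U⁻¹.map (Int.cast : ℤ → ℝ))
    (by rw [Matrix.IsSymm, Matrix.transpose_mul, Matrix.transpose_mul, hP.eq,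
      Matrix.transpose_transpose, Matrix.mul_assoc]) fun x hx => by
      rw [value_conj, hPx, arithMin_conj Q hU]
      rw [mem_minVectors_conj Q hU, Matrix.mulVec_mulVec, Matrix.mul_nonsing_inv U hU,
        Matrix.one_mulVec]
      exact hx
  rw [← h]
  calc P = ((U.map (Int.cast : ℤ → ℝ))ᵀ * (U⁻¹.map (Int.cast : ℤ → ℝ))ᵀ) * P *
        (U⁻¹.map (Int.cast : ℤ → ℝ) * U.map (Int.cast : ℤ → ℝ)) := by
        rw [hinv, hinvt, Matrix.one_mul, Matrix.mul_one]
    _ = _ := by simp only [Matrix.mul_assoc]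

/-! ### Short minimal vectors by duality -/

/-- The Cauchy–Schwarz inequality for a form and its inverse. -/
theorem dotProduct_sq_le_mul {d : ℕ} {S Q : Matrix (Fin d) (Fin d) ℝ} (hQ : Q.PosDef)
    (hQS : Q * S = 1) (v y : Fin d → ℝ) :
    (v ⬝ᵥ y) ^ 2 ≤ (v ⬝ᵥ (S *ᵥ v)) * (y ⬝ᵥ (Q *ᵥ y)) := by
  set w := S *ᵥ v with hw
  have hQw : Q *ᵥ w = v := by rw [hw, Matrix.mulVec_mulVec, hQS, Matrix.one_mulVec]
  have hsymm : w ⬝ᵥ (Q *ᵥ y) = v ⬝ᵥ y := by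
    rw [Matrix.dotProduct_mulVec, ← Matrix.mulVec_transpose, (isSymm_of_posDef hQ).eq, hQw]
  -- The quadratic in `t` is the value of `Q` at `w + t • y`; its discriminant is therefore at most
  -- 0.
  have h : ∀ t : ℝ, 0 ≤ (y ⬝ᵥ (Q *ᵥ y)) * (t * t) + (2 * (v ⬝ᵥ y)) * t + v ⬝ᵥ w := by
    intro t
    have := hQ.posSemidef.dotProduct_mulVec_nonneg (w + t • y)
    rw [star_trivial, Matrix.mulVec_add, Matrix.mulVec_smul, hQw, add_dotProduct, dotProduct_add,
      dotProduct_add, dotProduct_smul, smul_dotProduct, smul_dotProduct, dotProduct_smul, hsymm,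
      dotProduct_comm w v, dotProduct_comm y v] at this
    simp only [smul_eq_mul] at this
    linarith
  have := discrim_le_zero h
  rw [discrim] at this
  linarith

theorem arithMin_nonneg {d : ℕ} {Q : Matrix (Fin d) (Fin d) ℝ} (hQ : Q.PosDef) :
    0 ≤ arithMin Q := by
  refine Real.sInf_nonneg ?_
  rintro _ ⟨x, -, rfl⟩
  exact hQ.posSemidef.dotProduct_mulVec_nonneg _

theorem arithMin_le {d : ℕ} {Q : Matrix (Fin d) (Fin d) ℝ} (hQ : Q.PosDef) {x : Fin d → ℤ}
    (hx : x ≠ 0) : arithMin Q ≤ value Q x := by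
  refine csInf_le ⟨0, ?_⟩ ⟨x, hx, rfl⟩
  rintro _ ⟨y, -, rfl⟩
  exact hQ.posSemidef.dotProduct_mulVec_nonneg _

/-- Every positive definite form is equivalent to one with short minimal vectors. -/
theorem exists_isUnit_minVectors_le {d : ℕ} (hd : 1 ≤ d) {Q : Matrix (Fin d) (Fin d) ℝ}
    (hQ : Q.PosDef) : ∃ U : Matrix (Fin d) (Fin d) ℤ, IsUnit U.det ∧
      ∀ x ∈ minVectors ((U.map (Int.cast : ℤ → ℝ))ᵀ * Q * U.map (Int.cast : ℤ → ℝ)),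
        ∑ i, (x i : ℝ) ^ 2 ≤ 1 / 8 * (d : ℝ) ^ 3 * ((d : ℝ) + 7) := by
  have hdet : IsUnit Q.det := hQ.det_pos.ne'.isUnit
  obtain ⟨V, hV, hVm⟩ := exists_isUnit_sum_value_le hQ.inv hQ (Matrix.nonsing_inv_mul Q hdet)
    (arithMin_nonneg hQ) fun x hx => arithMin_le hQ hx
  have hU : IsUnit (V⁻¹)ᵀ.det := by
    rw [Matrix.det_transpose]
    exact Matrix.isUnit_nonsing_inv_det V hV
  refine ⟨(V⁻¹)ᵀ, hU, fun x hx => ?_⟩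
  rw [mem_minVectors_conj Q hU] at hx
  set y := (V⁻¹)ᵀ *ᵥ x with hy
  have hyx : Vᵀ *ᵥ y = x := by
    rw [hy, Matrix.mulVec_mulVec, ← Matrix.transpose_mul, Matrix.nonsing_inv_mul V hV,
      Matrix.transpose_one, Matrix.one_mulVec]
  have hxi : ∀ i, (x i : ℝ) ^ 2 ≤ arithMin Q * value Q⁻¹ (V.col i) := by
    intro i
    have h1 : (x i : ℝ) = (fun j => (V.col i j : ℝ)) ⬝ᵥ fun j => (y j : ℝ) := by
      rw [← hyx]
      simp [Matrix.mulVec, dotProduct, Matrix.col]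
    have hx' : value Q y = arithMin Q := hx
    rw [h1, ← hx', mul_comm]
    exact dotProduct_sq_le_mul hQ (Matrix.mul_nonsing_inv Q hdet) _ _
  have hd1 : (1 : ℝ) ≤ d := by exact_mod_cast hd
  calc ∑ i, (x i : ℝ) ^ 2 ≤ arithMin Q * ∑ i, value Q⁻¹ (V.col i) := by
        rw [Finset.mul_sum]
        exact Finset.sum_le_sum fun i _ => hxi i
    _ ≤ (d : ℝ) * (d + 1) * (d ^ 2 + 5 * d + 2) / 16 := hVm
    _ ≤ 1 / 8 * (d : ℝ) ^ 3 * ((d : ℝ) + 7) := by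
      -- In `s = d - 1 ≥ 0` the difference of the two bounds has only non-negative coefficients.
      obtain ⟨s, hs⟩ : ∃ s : ℝ, (d : ℝ) = 1 + s := ⟨d - 1, by ring⟩
      have hs0 : 0 ≤ s := by linarith
      rw [hs, ← sub_nonneg]
      have : 1 / 8 * (1 + s) ^ 3 * (1 + s + 7) -
          (1 + s) * (1 + s + 1) * ((1 + s) ^ 2 + 5 * (1 + s) + 2) / 16 =
          (1 + s) * (s * (s ^ 2 + 11 * s + 12)) / 16 := by ring
      rw [this]
      positivity

end PerfectForms

theorem mainTheorem4 (d : ℕ) (hd : 1 ≤ d) (Q : Matrix (Fin d) (Fin d) ℝ)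
    (hQ : PerfectForms.IsPerfect Q) :
    ∃ Q' : Matrix (Fin d) (Fin d) ℝ,
      PerfectForms.IsPerfect Q' ∧ PerfectForms.ArithEquiv Q Q' ∧
        ∀ e : PerfectForms.UpperPairs d ≃ Fin (PerfectForms.symDim d),
          PerfectForms.ell d ≤
            (MeasureTheory.volume : MeasureTheory.Measure
              (EuclideanSpace ℝ (Fin (PerfectForms.symDim d)))).real
              (PerfectForms.phi e ''
                (PerfectForms.voronoiDomain Q' ∩ PerfectForms.traceHalfSpace d)) := by
  obtain ⟨U, hU, hshort⟩ := PerfectForms.exists_isUnit_minVectors_le hd hQ.1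
  exact ⟨_, hQ.conj hU, ⟨U, Int.isUnit_iff_abs_eq.1 hU, rfl⟩, fun e =>
    PerfectForms.le_volume_phi_image e (hQ.conj hU) hshort⟩
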